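/- Let $k\in\frac12+\mathbb N$ with $\mathbb N=\{1,2,\dots\}$, let $N,N'$ be positive integers divisible by $4$, and let $\psi,\psi'$ be Dirichlet characters modulo $N,N'$. All complex powers use the principal branch, and $q=e^{2\pi i z}$. For $\kappa\in\frac12+\mathbb Z$, $M^!_\kappa(N,\psi)$ is the space of weakly holomorphic modular forms of weight $\kappa$: holomorphic functions $f$ on the upper half-plane, meromorphic at all cusps, with $\left(\frac cd\right)\epsilon_d^{2\kappa}(cz+d)^{-\kappa}f(\gamma z)=\psi(d)f(z)$ for $\gamma=\left(\begin{smallmatrix}*&*\\c&d\end{smallmatrix}\right)\in\Gamma_0(N)$, where $\epsilon_d=1$ or $i$ according as $d\equiv1$ or $3\bmod 4$. $S^!_\kappa(N,\psi)$ is the subspace of those forms whose Fourier expansion at every cusp has zero constant term. For $M\in\mathbb N$ put $(f|_\kappa W_M)(z)=f(-1/(Mz))(\sqrt M z)^{-\kappa}$, and for functions $\varphi$ on $\mathbb R_+=(0,\infty)$ put $(\varphi|_\kappa W_M)(x)=\varphi(1/(Mx))(Mx)^{-\kappa}$. Let $(\mathcal L\varphi)(s)=\int_0^\infty e^{-st}\varphi(t)\,dt$.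 For a Dirichlet character $\chi$ modulo $D$ let $\tau_\chi(n)=\sum_{u\bmod D}\chi(u)e^{2\pi i nu/D}$. For $f=\sum_{n\ge-n_0}c_nq^n$ let $\mathcal F_{f_\chi}$ be the set of piecewise smooth $\varphi:\mathbb R_+\to\mathbb C$ for which $\sum_n|c_n\tau_{\bar\chi}(n)|\,(\mathcal L|\varphi|)(2\pi n/D)$ converges (terms with zero coefficient being omitted), and put $L_f(\chi,\varphi)=\sum_n c_n\tau_{\bar\chi}(n)(\mathcal L\varphi)(2\pi n/D)$. Assume that there are a bounded map $\ell:\mathbb Z\to\mathbb C$ and a linear map $T:M^!_{2-k}(N,\psi)\to M^!_k(N',\psi')$ sending each $f=\sum_{n\ge-n_0}c_nq^n$ to $$f_1=\sum_{n\ge-n_0}c_n\,\ell(n)\,n^{k-1}q^n .$$ Assume further that whenever $f|_{2-k}W_N=cf$ with $c\in\mathbb C$, then $f_1|_kW_{N'}=c\lambda f_1$ for some $\lambda=\lambda_f\in\mathbb C$ (which may depend on $f$). Let $h:\mathbb R\to\mathbb C$ be smooth on $\mathbb R_+$ with $h(n)=\ell(n)$ for all $n\in\mathbb Z$. For $D\in\mathbb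 N$ and a test function $\varphi$ let $$\alpha_D(\varphi)=\mathcal L^{-1}\!\left(\Big(\tfrac{Dp}{2\pi}\Big)^{k-1}h\Big(\tfrac{Dp}{2\pi}\Big)(\mathcal L\varphi)(p)\right),$$ that is, a function $A$ whose Laplace integral converges absolutely on some half-line and equals the expression in brackets at each real $p\ne0$ at which it converges absolutely. Let $f\in S^!_{2-k}(N,\psi)$ satisfy $f|_{2-k}W_N=cf$ for some $c\in\mathbb C$, let $D\in\mathbb N$ with $(D,NN')=1$, let $\chi$ be a Dirichlet character modulo $D$, and let $\psi_D=\left(\frac{\cdot}{D}\right)$. Let $\varphi$ be a piecewise smooth, compactly supported function on $\mathbb R_+$ such that $\alpha_D(\varphi)$ and $\alpha_D(\varphi|_{2-k}W_{N'})$ exist and such that $\alpha_D(\varphi)\in\mathcal F_{f_\chi}$ and both $\alpha_D(\varphi)|_kW_N$ and $\alpha_D(\varphi|_{2-k}W_{N'})$ lie in $\mathcal F_{f_{\bar\chi\psi_D}}$. Then $$L_f\big(\bar\chi\psi_D,\ \alpha_D(\varphi)|_kW_N\big)=L_f\big(\bar\chi\psi_D,\ b\,\alpha_D(\varphi|_{2-k}W_{N'})\big),$$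 where, with $N'/N$ formed in $\mathbb Z/D\mathbb Z$ inside the characters, $$b=i^{2k-2}\,\lambda_f\,\psi_D\!\Big((-1)^{2k}\frac{N'}{N}\Big)\,\chi\!\Big(\frac{N'}{N}\Big)\,\frac{\psi'(D)}{\psi(D)}\,(NN')^{-k/2}\,N'.$$ -/

import Mathlib

open scoped UpperHalfPlane Manifold ContDiff Topology

noncomputable section

namespace HalfIntegralBol

/-! ### Slash actions -/

/-- `ε_d` for an odd integer `d`: it is `1` if `d ≡ 1 mod 4` and `i` if `d ≡ 3 mod 4`. -/
def eps (d : ℤ) : ℂ := if d % 4 = 1 then 1 else Complex.I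

/-- The Kronecker symbol `(c / d)` for an odd integer `d`, which may be negative. -/
def kroneckerOdd (c d : ℤ) : ℤ :=
  if c < 0 ∧ d < 0 then -jacobiSym c d.natAbs else jacobiSym c d.natAbs

/-- The slash action of weight `k ∈ 1/2 + ℤ` of a matrix in `Γ₀(N)`, `4 ∣ N`:
`(c / d) ε_d ^ (2k) (cz + d) ^ (-k) f(γ z)`, with the principal branch of the power. -/
def slashGamma (k : ℝ) (f : ℍ → ℂ) (γ : Matrix.SpecialLinearGroup (Fin 2) ℤ) (z : ℍ) : ℂ :=
  (kroneckerOdd (γ 1 0) (γ 1 1) : ℂ) * eps (γ 1 1) ^ ((2 * k : ℝ) : ℂ) *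
    ((γ 1 0 : ℂ) * (z : ℂ) + (γ 1 1 : ℂ)) ^ (-(k : ℂ)) * f (γ • z)

/-- `(cz + d) ^ (-k) f(ρ z)` for `ρ ∈ SL₂(ℤ)`: the function whose expansion at `∞` is the expansion
of `f` at the cusp `ρ ∞`. -/
def atCusp (k : ℝ) (f : ℍ → ℂ) (ρ : Matrix.SpecialLinearGroup (Fin 2) ℤ) (z : ℍ) : ℂ :=
  ((ρ 1 0 : ℂ) * (z : ℂ) + (ρ 1 1 : ℂ)) ^ (-(k : ℂ)) * f (ρ • z)

/-- The Fricke matrix `W_M = (0, -1/√M; √M, 0)`. -/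
def frickeMatrix (M : ℕ) [NeZero M] : Matrix.SpecialLinearGroup (Fin 2) ℝ :=
  ⟨!![0, -(√(M : ℝ))⁻¹; √(M : ℝ), 0], by
    have h : √(M : ℝ) ≠ 0 := by
      have : (0 : ℝ) < M := by exact_mod_cast Nat.pos_of_ne_zero (NeZero.ne M)
      positivity
    simp [Matrix.det_fin_two, h]⟩

/-- `(f |_k W_M)(z) = f(W_M z) (√M z) ^ (-k)` on functions on the upper half-plane. -/
def fricke (k : ℝ) (M : ℕ) [NeZero M] (f : ℍ → ℂ) (z : ℍ) : ℂ :=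
  f (frickeMatrix M • z) * (((√(M : ℝ) : ℝ) : ℂ) * (z : ℂ)) ^ (-(k : ℂ))

/-! ### Weakly holomorphic modular forms -/

/-- `f(z) = ∑_{n ≥ -n₀} a(n) exp(2 π i n z / M)` on the upper half-plane, for some `n₀`. -/
def HasFourierExpansion (M : ℕ) (f : ℍ → ℂ) (a : ℤ → ℂ) : Prop :=
  (∃ n₀ : ℤ, ∀ n : ℤ, n < -n₀ → a n = 0) ∧
    ∀ z : ℍ, HasSum
      (fun n : ℤ => a n * Complex.exp (2 * Real.pi * Complex.I * n * (z : ℂ) / M)) (f z)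

theorem HasFourierExpansion.add {M : ℕ} {f g : ℍ → ℂ} {a b : ℤ → ℂ}
    (hf : HasFourierExpansion M f a) (hg : HasFourierExpansion M g b) :
    HasFourierExpansion M (f + g) (a + b) := by
  obtain ⟨⟨n₁, h₁⟩, hf⟩ := hf
  obtain ⟨⟨n₂, h₂⟩, hg⟩ := hg
  refine ⟨⟨max n₁ n₂, fun n hn => ?_⟩, fun z => ?_⟩
  · have := le_max_left n₁ n₂
    have := le_max_right n₁ n₂
    simp [h₁ n (by omega), h₂ n (by omega)]
  · simpa [add_mul] using (hf z).add (hg z)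

theorem HasFourierExpansion.smul {M : ℕ} {f : ℍ → ℂ} {a : ℤ → ℂ}
    (hf : HasFourierExpansion M f a) (c : ℂ) :
    HasFourierExpansion M (c • f) (c • a) := by
  obtain ⟨⟨n₁, h₁⟩, hf⟩ := hf
  refine ⟨⟨n₁, fun n hn => by simp [h₁ n hn]⟩, fun z => ?_⟩
  simpa [mul_assoc] using (hf z).mul_left c

theorem HasFourierExpansion.zero (M : ℕ) : HasFourierExpansion M 0 0 :=
  ⟨⟨0, fun _ _ => rfl⟩, fun z => by simp [hasSum_zero]⟩

theorem HasFourierExpansion.refine {M : ℕ} {f : ℍ → ℂ} {a : ℤ → ℂ}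
    (hf : HasFourierExpansion M f a) (L : ℕ) (hL : 0 < L) :
    ∃ b, HasFourierExpansion (M * L) f b := by
  obtain ⟨⟨n₁, h₁⟩, hf⟩ := hf
  have hL0 : (L : ℤ) ≠ 0 := by exact_mod_cast hL.ne'
  have hLC : (L : ℂ) ≠ 0 := by exact_mod_cast hL.ne'
  have hinj : Function.Injective (fun n : ℤ => n * (L : ℤ)) :=
    fun x y hxy => mul_right_cancel₀ hL0 hxy
  refine ⟨fun n => if (L : ℤ) ∣ n then a (n / L) else 0, ⟨n₁ * L, fun n hn => ?_⟩, fun z => ?_⟩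
  · by_cases hd : (L : ℤ) ∣ n
    · show (if (L : ℤ) ∣ n then a (n / L) else 0) = 0
      rw [if_pos hd]
      obtain ⟨m, rfl⟩ := hd
      rw [Int.mul_ediv_cancel_left _ hL0]
      refine h₁ m ?_
      have hLp : (0 : ℤ) < L := by exact_mod_cast hL
      nlinarith
    · exact if_neg hd
  · refine (hinj.hasSum_iff ?_).mp ?_
    · intro n hn
      have : ¬ (L : ℤ) ∣ n := fun ⟨m, hm⟩ => hn ⟨m, by simp [hm, mul_comm]⟩
      simp [this]
    · convert hf z using 2 with n
      have e1 : n * (L : ℤ) / L = n := Int.mul_ediv_cancel _ hL0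
      simp only [Function.comp, dvd_mul_left, if_true, e1]
      congr 2
      push_cast
      rw [show (2 * (Real.pi : ℂ) * Complex.I * ((n : ℂ) * L) * (z : ℂ)) =
        (2 * (Real.pi : ℂ) * Complex.I * n * (z : ℂ)) * L by ring]
      exact mul_div_mul_right _ _ hLC

/-- The space `M^!_k(N, ψ)`, `k ∈ 1/2 + ℤ`, `4 ∣ N`: holomorphic functions on the upper half-plane
with `f |_k γ = ψ(d) f` for all `γ ∈ Γ₀(N)`, and meromorphic at every cusp. -/
def WeaklyHolomorphic (k : ℝ) (N : ℕ) (ψ : DirichletCharacter ℂ N) : Submodule ℂ (ℍ → ℂ) where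
  carrier := {f | MDifferentiable 𝓘(ℂ) 𝓘(ℂ) f ∧
    (∀ γ ∈ CongruenceSubgroup.Gamma0 N, ∀ z : ℍ,
      slashGamma k f γ z = ψ ((γ 1 1 : ℤ) : ZMod N) * f z) ∧
    ∀ ρ : Matrix.SpecialLinearGroup (Fin 2) ℤ, ∃ M : ℕ, 0 < M ∧
      ∃ a : ℤ → ℂ, HasFourierExpansion M (atCusp k f ρ) a}
  zero_mem' := by
    refine ⟨mdifferentiable_const, fun γ _ z => by simp [slashGamma], fun ρ => ⟨1, one_pos, 0, ?_⟩⟩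
    have : atCusp k 0 ρ = 0 := by ext z; simp [atCusp]
    rw [this]
    exact HasFourierExpansion.zero 1
  add_mem' := by
    rintro f g ⟨hf1, hf2, hf3⟩ ⟨hg1, hg2, hg3⟩
    refine ⟨hf1.add hg1, fun γ hγ z => ?_, fun ρ => ?_⟩
    · have h1 := hf2 γ hγ z
      have h2 := hg2 γ hγ z
      simp only [slashGamma, Pi.add_apply, mul_add] at h1 h2 ⊢
      rw [h1, h2]
    · obtain ⟨M₁, hM₁, a, ha⟩ := hf3 ρ
      obtain ⟨M₂, hM₂, b, hb⟩ := hg3 ρ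
      obtain ⟨a', ha'⟩ := ha.refine M₂ hM₂
      obtain ⟨b', hb'⟩ := hb.refine M₁ hM₁
      rw [mul_comm] at hb'
      refine ⟨M₁ * M₂, Nat.mul_pos hM₁ hM₂, a' + b', ?_⟩
      have : atCusp k (f + g) ρ = atCusp k f ρ + atCusp k g ρ := by
        ext z; simp [atCusp, mul_add]
      rw [this]
      exact ha'.add hb'
  smul_mem' := by
    rintro c f ⟨hf1, hf2, hf3⟩
    refine ⟨hf1.const_smul c, fun γ hγ z => ?_, fun ρ => ?_⟩
    · have h1 := hf2 γ hγ z
      simp only [slashGamma, Pi.smul_apply, smul_eq_mul] at h1 ⊢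
      rw [mul_left_comm, h1, mul_left_comm]
    · obtain ⟨M₁, hM₁, a, ha⟩ := hf3 ρ
      refine ⟨M₁, hM₁, c • a, ?_⟩
      have : atCusp k (c • f) ρ = c • atCusp k f ρ := by
        ext z; simp [atCusp, mul_left_comm]
      rw [this]
      exact ha.smul c

/-- The condition that cuts out `S^!_k(N, ψ)` in `M^!_k(N, ψ)`: the constant term of the Fourier
expansion at each cusp vanishes. -/
def IsCuspidal (k : ℝ) (f : ℍ → ℂ) : Prop :=
  ∀ ρ : Matrix.SpecialLinearGroup (Fin 2) ℤ, ∃ M : ℕ, 0 < M ∧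
    ∃ a : ℤ → ℂ, HasFourierExpansion M (atCusp k f ρ) a ∧ a 0 = 0

/-! ### Characters and Gauss sums -/

/-- The real character `ψ_D(u) = (u / D)` modulo `D`. -/
def jacobiChar (D : ℕ) [NeZero D] : DirichletCharacter ℂ D where
  toFun u := ((jacobiSym (u.val : ℤ) D : ℤ) : ℂ)
  map_one' := by
    have h : jacobiSym (((1 : ZMod D).val : ℕ) : ℤ) D = jacobiSym 1 D := by
      rw [jacobiSym.mod_left 1 D, jacobiSym.mod_left _ D, ZMod.val_one_eq_one_mod]
      congr 1
      push_cast
      simp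
    rw [h, jacobiSym.one_left]
    simp
  map_mul' u v := by
    have h : jacobiSym (((u * v : ZMod D).val : ℕ) : ℤ) D
        = jacobiSym ((u.val : ℤ) * (v.val : ℤ)) D := by
      rw [jacobiSym.mod_left ((u.val : ℤ) * (v.val : ℤ)) D, ZMod.val_mul]
      push_cast
      rfl
    rw [h, jacobiSym.mul_left]
    push_cast
    rfl
  map_nonunit' u hu := by
    have : jacobiSym (u.val : ℤ) D = 0 := by
      rw [jacobiSym.eq_zero_iff_not_coprime]
      intro hc
      apply hu
      have h2 : Nat.Coprime u.val D := by
        rwa [Int.gcd_natCast_natCast] at hc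
      have := (ZMod.isUnit_iff_coprime u.val D).mpr h2
      simpa using this
    rw [this, Int.cast_zero]

/-- The generalized Gauss sum `τ_χ(n) = ∑_{u mod D} χ(u) exp(2 π i n u / D)`. -/
def gaussSumAt {D : ℕ} [NeZero D] (χ : DirichletCharacter ℂ D) (n : ℤ) : ℂ :=
  ∑ u : ZMod D, χ u * Complex.exp (2 * Real.pi * Complex.I * n * (u.val : ℂ) / D)

/-- The coefficients `c(n) τ_{χ̄}(n)` of the twist `f_χ(z) = ∑ c(n) τ_{χ̄}(n) exp(2 π i n z / D)`
of `f(z) = ∑ c(n) exp(2 π i n z)`. The conjugate of a Dirichlet character is its inverse. -/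
def twistCoeff (c : ℤ → ℂ) {D : ℕ} [NeZero D] (χ : DirichletCharacter ℂ D) (n : ℤ) : ℂ :=
  c n * gaussSumAt χ⁻¹ n

/-! ### Test functions, Laplace transforms and `L`-series -/

/-- Piecewise smooth on `(0, ∞)`: near every point `x > 0`, the function coincides on either side
of `x` with a smooth function. So the break points are locally finite in `(0, ∞)`. -/
def PiecewiseSmooth (φ : ℝ → ℂ) : Prop :=
  ∀ x : ℝ, 0 < x → ∃ g₁ g₂ : ℝ → ℂ, ContDiff ℝ ∞ g₁ ∧ ContDiff ℝ ∞ g₂ ∧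
    φ =ᶠ[𝓝[<] x] g₁ ∧ φ =ᶠ[𝓝[>] x] g₂

/-- The Laplace integral of `φ` converges absolutely at `s`. -/
def LaplaceConverges (φ : ℝ → ℂ) (s : ℝ) : Prop :=
  MeasureTheory.IntegrableOn (fun t : ℝ => (Real.exp (-(s * t)) : ℂ) * φ t) (Set.Ioi 0)

/-- The Laplace transform `(𝓛 φ)(s) = ∫_0^∞ exp(-s t) φ(t) dt`. -/
def laplace (φ : ℝ → ℂ) (s : ℝ) : ℂ :=
  ∫ t in Set.Ioi (0 : ℝ), (Real.exp (-(s * t)) : ℂ) * φ t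

/-- The class `𝓕_f` for `f(z) = ∑ c(n) exp(2 π i n z / M)`: the piecewise smooth `φ` such that
`∑ |c(n)| (𝓛 |φ|)(2 π n / M)` converges. -/
def testClass (c : ℤ → ℂ) (M : ℕ) : Set (ℝ → ℂ) :=
  {φ | PiecewiseSmooth φ ∧
    (∀ n : ℤ, c n ≠ 0 → LaplaceConverges φ (2 * Real.pi * n / M)) ∧
    Summable fun n : ℤ =>
      ‖c n‖ * ∫ t in Set.Ioi (0 : ℝ), Real.exp (-(2 * Real.pi * n / M * t)) * ‖φ t‖}

/-- `L_f(χ, φ) = ∑ c(n) τ_{χ̄}(n) (𝓛 φ)(2 π n / D)` for `f(z) = ∑ c(n) exp(2 π i n z)`. -/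
def LValue (c : ℤ → ℂ) {D : ℕ} [NeZero D] (χ : DirichletCharacter ℂ D) (φ : ℝ → ℂ) : ℂ :=
  ∑' n : ℤ, twistCoeff c χ n * laplace φ (2 * Real.pi * n / D)

/-- `(φ |_k W_M)(x) = φ(1 / (M x)) (M x) ^ (-k)` on functions of a positive real variable. -/
def testFricke (k : ℝ) (M : ℕ) (φ : ℝ → ℂ) (x : ℝ) : ℂ :=
  φ ((M * x)⁻¹) * (((M * x) ^ (-k) : ℝ) : ℂ)

/-- `A` is an inverse Laplace transform of `F`: the Laplace integral of `A` converges absolutely on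
some half-line, and its value is `F(p)` at every real `p ≠ 0` at which it converges absolutely.
The values for large `p` determine `A` almost everywhere on `(0, ∞)`. -/
def IsInverseLaplace (F : ℝ → ℂ) (A : ℝ → ℂ) : Prop :=
  (∃ σ : ℝ, LaplaceConverges A σ) ∧
    ∀ p : ℝ, p ≠ 0 → LaplaceConverges A p → laplace A p = F p

/-- `A = α_D(φ)`, where
`α_D(φ) = 𝓛⁻¹ ((D p / 2π) ^ (k - 1) h(D p / 2π) (𝓛 φ)(p))`. -/
def IsAlpha (k : ℝ) (h : ℝ → ℂ) (D : ℕ) (φ A : ℝ → ℂ) : Prop :=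
  IsInverseLaplace
    (fun p => ((D * p / (2 * Real.pi) : ℝ) : ℂ) ^ ((k - 1 : ℝ) : ℂ) *
      h (D * p / (2 * Real.pi)) * laplace φ p) A

/-- The constant
`b = i ^ (2k-2) λ ψ_D((-1) ^ (2k) N' / N) χ(N' / N) (ψ'(D) / ψ(D)) (N N') ^ (-k/2) N'`
for `k = m + 1/2`; here `N' / N` is formed in `ℤ / D`. -/
def bConst (m : ℕ) (k : ℝ) {N N' : ℕ} (ψ : DirichletCharacter ℂ N) (ψ' : DirichletCharacter ℂ N')
    {D : ℕ} [NeZero D] (χ : DirichletCharacter ℂ D) (lam : ℂ) : ℂ :=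
  Complex.I ^ (2 * (m : ℤ) - 1) * lam *
    jacobiChar D ((-1) ^ (2 * m + 1) * ((N' : ZMod D) * (N : ZMod D)⁻¹)) *
    χ ((N' : ZMod D) * (N : ZMod D)⁻¹) *
    (ψ' (D : ZMod N') / ψ (D : ZMod N)) *
    ((((N : ℝ) * N') ^ (-(k / 2)) : ℝ) : ℂ) * N'

end HalfIntegralBol

end

noncomputable section

namespace HalfIntegralBol

open MeasureTheory Set

/-! ### Twists -/

/-! Write `g = T f`, `A = α_D(φ)`, `B = α_D(φ|W_{N'})`. Both sides are compared with the single
number `L_f(χ, A) = L_g(χ, φ)`.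

The twist `f_χ(z) = ∑ χ̄(u) f((z + u)/D)` has coefficients `c_n τ_χ̄(n)`, so absolute convergence
gives `L_f(χ, φ) = ∫ f_χ(it) φ(t) dt` (`LValue_eq_integral`). Modularity under `Γ₀(N)` shows that
`W_N` carries `f_χ` to an explicit multiple of `(f|W_N)_{χ̄ψ_D}` (`twist_frickeMatrix_smul`). The
substitution `t = 1/(Nx)` turns this into a functional equation for the integrals
(`integral_twist_functional_equation`).

Applied in weight `2 - k` to `f` and `A`, it relates `L_f(χ, A)` to `c L_f(χ̄ψ_D, A|W_N)`. Applied
in weight `k` to `g` and `φ`, it relates `L_g(χ, φ)` to `c λ L_g(χ̄ψ_D, φ|W_{N'})`. Evaluating the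
Laplace transforms at `p = 2πn/D` moves the factor `ℓ(n) n^(k-1)` from the coefficients into the
test function, so `L_g(χ, φ) = L_f(χ, A)` and `L_g(χ̄ψ_D, φ|W_{N'}) = L_f(χ̄ψ_D, B)`
(`LValue_eq_of_isAlpha`). Cuspidality removes `n = 0`, where `α_D` gives no information. The number
`b` is the quotient of the constants in the two functional equations (`constants_eq`); the common
factor `c` cancels, and `c = 0` forces `f = 0`. -/

/-- The point `(z + u) / D` of the upper half-plane. -/
def twistPoint (D : ℕ) [NeZero D] (u : ZMod D) (z : ℍ) : ℍ :=
  ⟨((z : ℂ) + (u.val : ℂ)) / D, by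
    have hD : (0 : ℝ) < D := by exact_mod_cast Nat.pos_of_ne_zero (NeZero.ne D)
    rw [Complex.div_natCast_im, Complex.add_im, Complex.natCast_im, add_zero]
    exact div_pos z.im_pos hD⟩

theorem coe_twistPoint (D : ℕ) [NeZero D] (u : ZMod D) (z : ℍ) :
    (twistPoint D u z : ℂ) = ((z : ℂ) + (u.val : ℂ)) / D := rfl

/-- The twist `f_χ(z) = ∑_{u mod D} χ⁻¹(u) f((z + u) / D)`. -/
def twist (f : ℍ → ℂ) {D : ℕ} [NeZero D] (χ : DirichletCharacter ℂ D) (z : ℍ) : ℂ :=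
  ∑ u : ZMod D, χ⁻¹ u * f (twistPoint D u z)

theorem twist_smul (c : ℂ) (f : ℍ → ℂ) {D : ℕ} [NeZero D] (χ : DirichletCharacter ℂ D) (z : ℍ) :
    twist (c • f) χ z = c * twist f χ z := by
  simp only [twist, Pi.smul_apply, smul_eq_mul, Finset.mul_sum]
  exact Finset.sum_congr rfl fun u _ => by ring

/-- The shift by `u` multiplies the `n`-th term by `exp(2πinu/D)`; summing against `χ̄(u)` produces
the Gauss sum. -/
theorem HasFourierExpansion.hasSum_twist {f : ℍ → ℂ} {a : ℤ → ℂ} (hf : HasFourierExpansion 1 f a)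
    {D : ℕ} [NeZero D] (χ : DirichletCharacter ℂ D) (z : ℍ) :
    HasSum (fun n : ℤ => twistCoeff a χ n *
      Complex.exp (2 * Real.pi * Complex.I * n * (z : ℂ) / D)) (twist f χ z) := by
  have h := hasSum_sum (s := Finset.univ)
    fun (u : ZMod D) _ => (hf.2 (twistPoint D u z)).mul_left (χ⁻¹ u)
  refine h.congr_fun ?_
  intro n
  simp only [twistCoeff, gaussSumAt, Finset.mul_sum, Finset.sum_mul]
  refine Finset.sum_congr rfl fun u _ => ?_
  rw [coe_twistPoint]
  have : (2 * Real.pi * Complex.I * n * (((z : ℂ) + (u.val : ℂ)) / D) / ((1 : ℕ) : ℂ)) =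
    2 * Real.pi * Complex.I * n * (u.val : ℂ) / D + 2 * Real.pi * Complex.I * n * (z : ℂ) / D := by
    push_cast; ring
  rw [this, Complex.exp_add]
  ring

/-! ### Twists under the Fricke involution -/

theorem jacobiChar_intCast (D : ℕ) [NeZero D] (n : ℤ) :
    jacobiChar D (n : ZMod D) = ((jacobiSym n D : ℤ) : ℂ) := by
  change ((jacobiSym (((n : ZMod D).val : ℕ) : ℤ) D : ℤ) : ℂ) = _
  rw [jacobiSym.mod_left n D, jacobiSym.mod_left _ D, ZMod.val_intCast]
  simp

theorem eps_ne_zero (d : ℤ) : eps d ≠ 0 := by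
  unfold eps; split_ifs <;> simp

/-- Both arguments lie in `(0, π)`, so their difference stays in the principal range and no branch
jump occurs. -/
theorem cpow_div_mul_cpow {z w : ℂ} (hz : 0 < z.im) (hw : 0 < w.im) (κ : ℂ) :
    (z / w) ^ κ * w ^ κ = z ^ κ := by
  have hz0 : z ≠ 0 := by rintro rfl; simp at hz
  have hw0 : w ≠ 0 := by rintro rfl; simp at hw
  have hzw : z / w ≠ 0 := div_ne_zero hz0 hw0
  have harg : z.arg - w.arg ∈ Ioc (-Real.pi) Real.pi := by
    have h1 := Complex.arg_nonneg_iff.mpr hz.le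
    have h2 := Complex.arg_nonneg_iff.mpr hw.le
    have h3 := Complex.arg_le_pi z
    have h4 : w.arg < Real.pi := Complex.arg_lt_pi_iff.mpr (Or.inr hw.ne')
    constructor <;> linarith
  have hlog : Complex.log (z / w) = Complex.log z - Complex.log w := by
    apply Complex.ext
    · simp only [Complex.log_re, Complex.sub_re, norm_div]
      exact Real.log_div (norm_ne_zero_iff.mpr hz0) (norm_ne_zero_iff.mpr hw0)
    · simp only [Complex.log_im, Complex.sub_im]
      have h := Complex.arg_div_coe_angle hz0 hw0
      rw [← Real.Angle.coe_sub] at h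
      have h5 := congrArg Real.Angle.toReal h
      rw [Complex.arg_coe_angle_toReal_eq_arg,
        Real.Angle.toReal_coe_eq_self_iff_mem_Ioc.mpr harg] at h5
      exact h5
  rw [Complex.cpow_def_of_ne_zero hzw, Complex.cpow_def_of_ne_zero hw0,
    Complex.cpow_def_of_ne_zero hz0, ← Complex.exp_add, hlog]
  congr 1
  ring

theorem coe_frickeMatrix_smul (M : ℕ) [NeZero M] (z : ℍ) :
    ((frickeMatrix M • z : ℍ) : ℂ) = -1 / (M * (z : ℂ)) := by
  have hM : (0 : ℝ) < M := by exact_mod_cast Nat.pos_of_ne_zero (NeZero.ne M)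
  have hs : ((√(M : ℝ) : ℝ) : ℂ) ≠ 0 := by
    exact_mod_cast (Real.sqrt_pos.mpr hM).ne'
  have hs2 : ((√(M : ℝ) : ℝ) : ℂ) * ((√(M : ℝ) : ℝ) : ℂ) = M := by
    rw [← Complex.ofReal_mul, Real.mul_self_sqrt hM.le]; simp
  have hz : (z : ℂ) ≠ 0 := UpperHalfPlane.ne_zero z
  rw [UpperHalfPlane.coe_specialLinearGroup_apply]
  simp [frickeMatrix]
  rw [← hs2]
  field_simp

theorem frickeMatrix_smul_frickeMatrix_smul (M : ℕ) [NeZero M] (z : ℍ) :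
    frickeMatrix M • frickeMatrix M • z = z := by
  apply UpperHalfPlane.ext
  have hM : (M : ℂ) ≠ 0 := by exact_mod_cast NeZero.ne M
  have hz : (z : ℂ) ≠ 0 := UpperHalfPlane.ne_zero z
  rw [coe_frickeMatrix_smul, coe_frickeMatrix_smul]
  field_simp

theorem apply_frickeMatrix_smul (k : ℝ) (M : ℕ) [NeZero M] (f : ℍ → ℂ) (z : ℍ) :
    f (frickeMatrix M • z) =
      (((√(M : ℝ) : ℝ) : ℂ) * (z : ℂ)) ^ (k : ℂ) * fricke k M f z := by
  have hM : (0 : ℝ) < M := by exact_mod_cast Nat.pos_of_ne_zero (NeZero.ne M)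
  have h0 : ((√(M : ℝ) : ℝ) : ℂ) * (z : ℂ) ≠ 0 :=
    mul_ne_zero (by exact_mod_cast (Real.sqrt_pos.mpr hM).ne') (UpperHalfPlane.ne_zero z)
  rw [fricke, mul_left_comm, ← Complex.cpow_add _ _ h0]
  simp

/-- One term of the transformation of a twist under the Fricke involution. -/
theorem apply_twistPoint_frickeMatrix_smul {κ : ℝ} {N : ℕ} [NeZero N] {ψ : DirichletCharacter ℂ N}
    {f : ℍ → ℂ} (hf : ∀ γ ∈ CongruenceSubgroup.Gamma0 N, ∀ z : ℍ,
      slashGamma κ f γ z = ψ ((γ 1 1 : ℤ) : ZMod N) * f z)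
    {D : ℕ} [NeZero D] {u v : ZMod D} (huv : u * v * N = -1) (z : ℍ) :
    eps D ^ ((2 * κ : ℝ) : ℂ) * f (twistPoint D u (frickeMatrix N • z)) =
      ψ (D : ZMod N) * jacobiChar D (N * v) * (((√(N : ℝ) : ℝ) : ℂ) * (z : ℂ)) ^ (κ : ℂ) *
        fricke κ N f (twistPoint D v z) := by
  have hN : (0 : ℝ) < N := by exact_mod_cast Nat.pos_of_ne_zero (NeZero.ne N)
  have hND : (N : ℂ) ≠ 0 := by exact_mod_cast NeZero.ne N
  have hDC : (D : ℂ) ≠ 0 := by exact_mod_cast NeZero.ne D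
  have hz : (z : ℂ) ≠ 0 := UpperHalfPlane.ne_zero z
  -- `a` completes the bottom row `(Nv, D)` and the entry `u` to a matrix of determinant `aD - uvN =
  -- 1`.
  obtain ⟨a, ha⟩ : (D : ℤ) ∣ 1 + u.val * v.val * N := by
    rw [← ZMod.intCast_zmod_eq_zero_iff_dvd]
    push_cast
    rw [ZMod.natCast_zmod_val, ZMod.natCast_zmod_val, huv]
    ring
  let γ : Matrix.SpecialLinearGroup (Fin 2) ℤ :=
    ⟨!![a, u.val; N * v.val, D], by rw [Matrix.det_fin_two_of]; linarith⟩
  have h10 : γ 1 0 = N * v.val := rfl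
  have h11 : γ 1 1 = D := rfl
  have h00 : γ 0 0 = a := rfl
  have h01 : γ 0 1 = u.val := rfl
  have hγ : γ ∈ CongruenceSubgroup.Gamma0 N := by
    rw [CongruenceSubgroup.Gamma0_mem, h10]; simp
  set w' := twistPoint D v z with hw'
  have hw0 : (w' : ℂ) ≠ 0 := UpperHalfPlane.ne_zero w'
  have hzv : (z : ℂ) + (v.val : ℂ) ≠ 0 := by
    intro h0
    apply hw0
    rw [hw', coe_twistPoint, h0, zero_div]
  -- The identity behind the lemma is `γ W_N ((z + v)/D) = (W_N z + u)/D`; its automorphy factor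
  -- simplifies to `z / w'`.
  have hden : ((γ 1 0 : ℤ) : ℂ) * ((frickeMatrix N • w' : ℍ) : ℂ) + ((γ 1 1 : ℤ) : ℂ)
      = (z : ℂ) / w' := by
    rw [h10, h11, coe_frickeMatrix_smul, hw', coe_twistPoint]
    push_cast
    field_simp
    ring
  have hpt : γ • (frickeMatrix N • w') = twistPoint D u (frickeMatrix N • z) := by
    apply UpperHalfPlane.ext
    have haC : (D : ℂ) * a = 1 + u.val * v.val * N := by exact_mod_cast ha.symm
    have : ((γ • (frickeMatrix N • w') : ℍ) : ℂ) =
      (((γ 0 0 : ℤ) : ℂ) * ((frickeMatrix N • w' : ℍ) : ℂ) + ((γ 0 1 : ℤ) : ℂ)) /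
      (((γ 1 0 : ℤ) : ℂ) * ((frickeMatrix N • w' : ℍ) : ℂ) + ((γ 1 1 : ℤ) : ℂ)) := by
      rw [UpperHalfPlane.specialLinearGroup_apply]
      simp
    rw [this, hden, h00, h01, coe_frickeMatrix_smul, coe_twistPoint D u, coe_frickeMatrix_smul,
      hw', coe_twistPoint]
    push_cast
    field_simp
    linear_combination (-1 : ℂ) * haC
  have key := hf γ hγ (frickeMatrix N • w')
  rw [slashGamma, hden, hpt, apply_frickeMatrix_smul κ N f w', h10, h11] at key
  have hkr : ((kroneckerOdd ((N : ℤ) * v.val) (D : ℤ) : ℤ) : ℂ) = jacobiChar D (N * v) := by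
    have : ¬ ((N : ℤ) * v.val < 0 ∧ (D : ℤ) < 0) := by
      rintro ⟨-, h2⟩; omega
    rw [kroneckerOdd, if_neg this, Int.natAbs_natCast, ← jacobiChar_intCast]
    congr 1
    push_cast
    rw [ZMod.natCast_zmod_val]
  have hunit : IsUnit ((N : ZMod D) * v) := by
    refine IsUnit.of_mul_eq_one (-u) ?_
    linear_combination (-1 : ZMod D) * huv
  -- The symbol is `±1`, so it can be moved to the other side of the equation unchanged.
  have hsq : jacobiChar D (N * v) * jacobiChar D (N * v) = 1 := by
    have h1 : ((N : ZMod D) * v) = (((N : ℤ) * v.val : ℤ) : ZMod D) := by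
      push_cast
      rw [ZMod.natCast_zmod_val]
    have h2 : jacobiChar D (N * v) ≠ 0 := hunit.map (jacobiChar D) |>.ne_zero
    rw [h1, jacobiChar_intCast] at h2 ⊢
    rcases jacobiSym.trichotomy ((N : ℤ) * v.val) D with h3 | h3 | h3
    · exact absurd (by rw [h3]; simp) h2
    · rw [h3]; simp
    · rw [h3]; simp
  have hzw : (z : ℂ) / w' ≠ 0 := div_ne_zero hz hw0
  have hcp : ((z : ℂ) / w') ^ (κ : ℂ) * (((√(N : ℝ) : ℝ) : ℂ) * (w' : ℂ)) ^ (κ : ℂ) =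
      (((√(N : ℝ) : ℝ) : ℂ) * (z : ℂ)) ^ (κ : ℂ) := by
    have hs : (0 : ℝ) < √(N : ℝ) := Real.sqrt_pos.mpr hN
    have := cpow_div_mul_cpow (z := ((√(N : ℝ) : ℝ) : ℂ) * (z : ℂ))
      (w := ((√(N : ℝ) : ℝ) : ℂ) * (w' : ℂ)) (by simpa using mul_pos hs z.im_pos)
      (by simpa using mul_pos hs w'.im_pos) κ
    rwa [mul_div_mul_left _ _ (by exact_mod_cast hs.ne')] at this
  have hinv : ((z : ℂ) / w') ^ (κ : ℂ) * ((z : ℂ) / w') ^ (-(κ : ℂ)) = 1 := by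
    rw [← Complex.cpow_add _ _ hzw]; simp
  rw [hkr] at key
  rw [← hcp]
  simp only [Int.cast_natCast] at key
  linear_combination (jacobiChar D (N * v) * ((z : ℂ) / w') ^ (κ : ℂ)) * key -
    eps D ^ ((2 * κ : ℝ) : ℂ) * f (twistPoint D u (frickeMatrix N • z)) *
      (((z : ℂ) / w') ^ (κ : ℂ) * ((z : ℂ) / w') ^ (-(κ : ℂ)) * hsq + hinv)

/-- The transformation of a twist under the Fricke involution. -/
theorem twist_frickeMatrix_smul {κ : ℝ} {N : ℕ} [NeZero N] {ψ : DirichletCharacter ℂ N}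
    {f : ℍ → ℂ} (hf : ∀ γ ∈ CongruenceSubgroup.Gamma0 N, ∀ z : ℍ,
      slashGamma κ f γ z = ψ ((γ 1 1 : ℤ) : ZMod N) * f z)
    {D : ℕ} [NeZero D] (hND : IsUnit (N : ZMod D)) (χ : DirichletCharacter ℂ D) (z : ℍ) :
    eps D ^ ((2 * κ : ℝ) : ℂ) * twist f χ (frickeMatrix N • z) =
      ψ (D : ZMod N) * χ (-N) * jacobiChar D N * (((√(N : ℝ) : ℝ) : ℂ) * (z : ℂ)) ^ (κ : ℂ) *
        twist (fricke κ N f) (χ⁻¹ * jacobiChar D) z := by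
  obtain ⟨n, hn⟩ := hND
  -- Characters vanish off the units, so the sums can be reindexed by `u ↦ v = -(Nu)⁻¹`.
  have hunits : ∀ (η : DirichletCharacter ℂ D) (F : ZMod D → ℂ),
      ∑ u : ZMod D, η u * F u = ∑ u : (ZMod D)ˣ, η u * F u := by
    intro η F
    symm
    refine Finset.sum_of_injOn (fun u : (ZMod D)ˣ => (u : ZMod D)) (fun _ _ _ _ h => Units.ext h)
      (fun _ _ => Finset.mem_coe.mpr (Finset.mem_univ _)) ?_ (fun _ _ => rfl)
    intro u _ hu
    rw [η.map_nonunit, zero_mul]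
    rintro ⟨u', rfl⟩
    exact hu ⟨u', by simp, rfl⟩
  have hJinv : (χ⁻¹ * jacobiChar D)⁻¹ = χ * jacobiChar D := by
    have : (jacobiChar D)⁻¹ = jacobiChar D := by
      ext u
      rw [MulChar.inv_apply_eq_inv']
      have h1 : ((u : ZMod D)) = (((u : ZMod D).val : ℤ) : ZMod D) := by simp
      rw [h1, jacobiChar_intCast]
      rcases jacobiSym.trichotomy (((u : ZMod D).val : ℤ)) D with h3 | h3 | h3 <;> rw [h3] <;> simp
    rw [mul_inv, inv_inv, this]
  rw [twist, twist, hJinv, hunits, hunits, Finset.mul_sum, Finset.mul_sum]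
  refine Fintype.sum_equiv ((Equiv.mulLeft (-n)).trans (Equiv.inv _)) _ _ fun u => ?_
  set v : (ZMod D)ˣ := (-n * u)⁻¹ with hv
  have hvv : ((Equiv.mulLeft (-n)).trans (Equiv.inv _)) u = v := rfl
  rw [hvv]
  have huv : (u : ZMod D) * v * N = -1 := by
    have h1 := congrArg (Units.val) (mul_inv_cancel (-n * u))
    rw [← hv] at h1
    push_cast at h1
    rw [← hn]
    linear_combination (-1 : ZMod D) * h1
  have h := apply_twistPoint_frickeMatrix_smul hf huv z
  have hχ : χ⁻¹ u = χ (-N) * χ v := by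
    rw [← map_mul, MulChar.inv_apply]
    congr 1
    rw [Ring.inverse_unit]
    have h1 : u⁻¹ = -n * v := inv_eq_of_mul_eq_one_right (by
      rw [hv, mul_left_comm, ← mul_assoc, mul_inv_cancel])
    rw [h1, ← hn]
    push_cast
    rfl
  rw [hχ, MulChar.mul_apply]
  rw [map_mul] at h
  linear_combination χ (-N) * χ v * h

/-! ### Constant terms -/

/-- Integration along the line of height `1` isolates the constant term. The interval is `L` periods
long so that expansions of different widths can be compared on a common one. -/
theorem HasFourierExpansion.integral_eq {M : ℕ} (hM : 0 < M) {f : ℍ → ℂ} {a : ℤ → ℂ}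
    (hf : HasFourierExpansion M f a) (L : ℕ) :
    ∫ x in (0 : ℝ)..(M * L : ℕ), f (UpperHalfPlane.ofComplex (x + Complex.I)) =
      (M * L : ℕ) * a 0 := by
  have hMC : (M : ℂ) ≠ 0 := by exact_mod_cast hM.ne'
  set F : ℤ → ℝ → ℂ := fun n x =>
    a n * Complex.exp (2 * Real.pi * Complex.I * n * (x + Complex.I) / M) with hF
  have hsum : ∀ x : ℝ, HasSum (fun n => F n x) (f (UpperHalfPlane.ofComplex (x + Complex.I))) := by
    intro x
    have him : 0 < ((x : ℂ) + Complex.I).im := by simp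
    have h := hf.2 (UpperHalfPlane.ofComplex (x + Complex.I))
    rw [UpperHalfPlane.ofComplex_apply_of_im_pos him] at h ⊢
    exact h
  -- The norm of a term depends only on the height, so summability at `x = 0` controls the whole
  -- interval.
  have hnorm : ∀ n x, ‖F n x‖ = ‖F n 0‖ := by
    intro n x
    have : ∀ y : ℝ, (2 * Real.pi * Complex.I * n * (y + Complex.I) / M : ℂ) =
        ((2 * Real.pi * n * y / M : ℝ) : ℂ) * Complex.I + ((-(2 * Real.pi * n / M) : ℝ) : ℂ) := by
      intro y
      push_cast
      linear_combination (2 * Real.pi * n / M : ℂ) * Complex.I_mul_I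
    simp only [hF, norm_mul, this, Complex.exp_add, Complex.norm_exp_ofReal_mul_I]
  have hcont : ∀ n, Continuous (F n) := fun n => by simp only [hF]; fun_prop
  have hle : (0 : ℝ) ≤ (M * L : ℕ) := Nat.cast_nonneg _
  have h := hasSum_integral_of_summable_integral_norm (F := F)
    (μ := volume.restrict (Ioc (0 : ℝ) (M * L : ℕ)))
    (fun n => (hcont n).integrableOn_Ioc) (by
      simp only [hnorm, integral_const]
      exact (hsum 0).summable.norm.const_smul _)
  simp only [fun x : ℝ => (hsum x).tsum_eq, ← intervalIntegral.integral_of_le hle] at h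
  have hzero : ∀ n, n ≠ 0 → ∫ x in (0 : ℝ)..(M * L : ℕ), F n x = 0 := by
    intro n hn
    set w : ℂ := 2 * Real.pi * Complex.I * n / M with hw
    have hw0 : w ≠ 0 := by
      rw [hw]
      have : (n : ℂ) ≠ 0 := by exact_mod_cast hn
      exact div_ne_zero (mul_ne_zero Complex.two_pi_I_ne_zero this) hMC
    have : ∀ x : ℝ, F n x = a n * Complex.exp (w * Complex.I) * Complex.exp (w * x) := by
      intro x
      simp only [hF, mul_assoc, ← Complex.exp_add]
      congr 2
      rw [hw]; ring
    simp only [this, intervalIntegral.integral_const_mul]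
    rw [integral_exp_mul_complex hw0]
    have h1 : w * ((M * L : ℕ) : ℝ) = (n * L : ℤ) * (2 * Real.pi * Complex.I) := by
      rw [hw]; push_cast; field_simp
    rw [h1, Complex.exp_int_mul_two_pi_mul_I]
    simp
  have h0 : ∫ x in (0 : ℝ)..(M * L : ℕ), F 0 x = (M * L : ℕ) * a 0 := by
    simp [hF]
  rw [← h0]
  exact h.unique (hasSum_single 0 hzero)

/-- Needed because `IsCuspidal` only supplies some width and some expansion at each cusp. -/
theorem HasFourierExpansion.constantTerm_unique {M L : ℕ} (hM : 0 < M) (hL : 0 < L) {f : ℍ → ℂ}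
    {a b : ℤ → ℂ} (hf : HasFourierExpansion M f a) (hf' : HasFourierExpansion L f b) :
    a 0 = b 0 := by
  have h1 := hf.integral_eq hM L
  have h2 := hf'.integral_eq hL M
  rw [mul_comm L M] at h2
  have h3 : ((M * L : ℕ) : ℂ) ≠ 0 := by exact_mod_cast (Nat.mul_pos hM hL).ne'
  exact mul_left_cancel₀ h3 (h1.symm.trans h2)

theorem IsCuspidal.apply_zero {k : ℝ} {f : ℍ → ℂ} (hf : IsCuspidal k f) {a : ℤ → ℂ}
    (ha : HasFourierExpansion 1 f a) : a 0 = 0 := by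
  obtain ⟨M, hM, b, hb, hb0⟩ := hf 1
  have : atCusp k f 1 = f := by
    ext z
    simp [atCusp]
  rw [this] at hb
  rw [ha.constantTerm_unique one_pos hM hb, hb0]

/-! ### The `L`-series as an integral -/

/-- The point `i t` of the upper half-plane, for `t > 0`. -/
def imPoint (t : ℝ) : ℍ := UpperHalfPlane.ofComplex (t * Complex.I)

theorem coe_imPoint {t : ℝ} (ht : 0 < t) : (imPoint t : ℂ) = t * Complex.I := by
  rw [imPoint, UpperHalfPlane.ofComplex_apply_of_im_pos (by simpa using ht)]

theorem frickeMatrix_smul_imPoint (M : ℕ) [NeZero M] {t : ℝ} (ht : 0 < t) :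
    frickeMatrix M • imPoint t = imPoint (M * t)⁻¹ := by
  have hM : (0 : ℝ) < M := by exact_mod_cast Nat.pos_of_ne_zero (NeZero.ne M)
  have hMC : (M : ℂ) ≠ 0 := by exact_mod_cast NeZero.ne M
  have htC : (t : ℂ) ≠ 0 := by exact_mod_cast ht.ne'
  apply UpperHalfPlane.ext
  rw [coe_frickeMatrix_smul, coe_imPoint ht, coe_imPoint (by positivity)]
  push_cast
  field_simp
  simp

theorem HasFourierExpansion.hasSum_twist_imPoint {f : ℍ → ℂ} {a : ℤ → ℂ}
    (hf : HasFourierExpansion 1 f a) {D : ℕ} [NeZero D] (χ : DirichletCharacter ℂ D) {t : ℝ}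
    (ht : 0 < t) :
    HasSum (fun n : ℤ => twistCoeff a χ n * (Real.exp (-(2 * Real.pi * n / D * t)) : ℂ))
      (twist f χ (imPoint t)) := by
  refine (hf.hasSum_twist χ (imPoint t)).congr_fun fun n => ?_
  rw [coe_imPoint ht]
  push_cast
  congr 2
  linear_combination (-2 * Real.pi * n * t / D : ℂ) * Complex.I_mul_I

/-- The convergence conditions in the definition of the class `𝓕_f`. -/
def ConvergesAbsolutely (c : ℤ → ℂ) (M : ℕ) (φ : ℝ → ℂ) : Prop :=
  (∀ n : ℤ, c n ≠ 0 → LaplaceConverges φ (2 * Real.pi * n / M)) ∧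
    Summable fun n : ℤ =>
      ‖c n‖ * ∫ t in Set.Ioi (0 : ℝ), Real.exp (-(2 * Real.pi * n / M * t)) * ‖φ t‖

/-- The convergence conditions are exactly what allows sum and integral to be interchanged. -/
theorem LValue_eq_integral {f : ℍ → ℂ} {a : ℤ → ℂ} (hf : HasFourierExpansion 1 f a) {D : ℕ}
    [NeZero D] {χ : DirichletCharacter ℂ D} {φ : ℝ → ℂ}
    (hφ : ConvergesAbsolutely (twistCoeff a χ) D φ) :
    LValue a χ φ = ∫ t in Ioi (0 : ℝ), twist f χ (imPoint t) * φ t := by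
  set F : ℤ → ℝ → ℂ := fun n t =>
    twistCoeff a χ n * ((Real.exp (-(2 * Real.pi * n / D * t)) : ℂ) * φ t) with hF
  have hint : ∀ n, Integrable (F n) (volume.restrict (Ioi 0)) := by
    intro n
    by_cases h0 : twistCoeff a χ n = 0
    · simp [hF, h0]
    · exact (hφ.1 n h0).const_mul _
  have hsum : Summable fun n => ∫ t in Ioi (0 : ℝ), ‖F n t‖ := by
    refine hφ.2.congr fun n => ?_
    rw [← integral_const_mul]
    simp only [hF, norm_mul, Complex.norm_real, Real.norm_eq_abs, Real.abs_exp]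
  have h := (hasSum_integral_of_summable_integral_norm hint hsum).tsum_eq
  have hL : LValue a χ φ = ∑' n, ∫ t in Ioi (0 : ℝ), F n t := by
    simp only [LValue, laplace, hF, integral_const_mul]
  rw [hL, h]
  refine setIntegral_congr_fun measurableSet_Ioi fun t ht => ?_
  have h1 := ((hf.hasSum_twist_imPoint χ ht).mul_right (φ t)).tsum_eq
  refine Eq.trans (tsum_congr fun n => ?_) h1
  simp only [hF, mul_assoc]

/-- The substitution `t = 1/(bx)`, done as `t = 1/y` followed by `y = bx`. -/
theorem integral_Ioi_comp_inv_mul (G : ℝ → ℂ) {b : ℝ} (hb : 0 < b) :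
    ∫ x in Ioi (0 : ℝ), ((b * ((b * x) ^ 2)⁻¹ : ℝ) : ℂ) * G (b * x)⁻¹ =
      ∫ t in Ioi (0 : ℝ), G t := by
  rw [← integral_comp_rpow_Ioi G (p := -1) (by norm_num)]
  have h := integral_comp_mul_left_Ioi (fun y : ℝ => (((y ^ 2)⁻¹ : ℝ) : ℂ) * G y⁻¹) 0 hb
  rw [mul_zero] at h
  have h2 : ∫ x in Ioi (0 : ℝ), (|(-1 : ℝ)| * x ^ ((-1 : ℝ) - 1)) • G (x ^ (-1 : ℝ)) =
      ∫ y in Ioi (0 : ℝ), (((y ^ 2)⁻¹ : ℝ) : ℂ) * G y⁻¹ := by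
    refine setIntegral_congr_fun measurableSet_Ioi fun x hx => ?_
    have hx' : (0 : ℝ) < x := hx
    have e1 : x ^ ((-1 : ℝ) - 1) = (x ^ 2)⁻¹ := by
      rw [show (-1 : ℝ) - 1 = -((2 : ℕ) : ℝ) by norm_num, Real.rpow_neg hx'.le,
        Real.rpow_natCast]
    simp only [e1, Real.rpow_neg_one, abs_neg, abs_one, one_mul, Complex.real_smul]
  rw [h2]
  calc _ = ∫ x in Ioi (0 : ℝ), (b : ℂ) * (((((b * x) ^ 2)⁻¹ : ℝ) : ℂ) * G (b * x)⁻¹) := by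
        congr 1; ext x; push_cast; ring
    _ = _ := by
        rw [integral_const_mul, h, Complex.real_smul, ← mul_assoc, Complex.ofReal_inv,
          mul_inv_cancel₀ (by exact_mod_cast hb.ne'), one_mul]

theorem integrableOn_Ioi_comp_inv_mul {G : ℝ → ℂ} (hG : IntegrableOn G (Ioi 0)) {b : ℝ}
    (hb : 0 < b) :
    IntegrableOn (fun x : ℝ => ((((b * x) ^ 2)⁻¹ : ℝ) : ℂ) * G (b * x)⁻¹) (Ioi 0) := by
  have h := (integrableOn_Ioi_comp_rpow_iff G (p := -1) (by norm_num)).mpr hG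
  have h2 : IntegrableOn (fun y : ℝ => (((y ^ 2)⁻¹ : ℝ) : ℂ) * G y⁻¹) (Ioi 0) := by
    refine h.congr_fun (fun x hx => ?_) measurableSet_Ioi
    have hx' : (0 : ℝ) < x := hx
    have e1 : x ^ ((-1 : ℝ) - 1) = (x ^ 2)⁻¹ := by
      rw [show (-1 : ℝ) - 1 = -((2 : ℕ) : ℝ) by norm_num, Real.rpow_neg hx'.le,
        Real.rpow_natCast]
    simp only [e1, Real.rpow_neg_one, abs_neg, abs_one, one_mul, Complex.real_smul]
  refine (integrableOn_Ioi_comp_mul_left_iff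
    (fun y : ℝ => (((y ^ 2)⁻¹ : ℝ) : ℂ) * G y⁻¹) 0 hb).mpr ?_
  rwa [mul_zero]

/-- The functional equation of the integrals of twists. -/
theorem integral_twist_functional_equation {κ : ℝ} {N : ℕ} [NeZero N] {ψ : DirichletCharacter ℂ N}
    {f : ℍ → ℂ} (hf : ∀ γ ∈ CongruenceSubgroup.Gamma0 N, ∀ z : ℍ,
      slashGamma κ f γ z = ψ ((γ 1 1 : ℤ) : ZMod N) * f z)
    {D : ℕ} [NeZero D] (hND : IsUnit (N : ZMod D)) (χ : DirichletCharacter ℂ D) (φ : ℝ → ℂ) :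
    eps D ^ ((2 * κ : ℝ) : ℂ) * ∫ t in Ioi (0 : ℝ), twist f χ (imPoint t) * φ t =
      ψ (D : ZMod N) * χ (-N) * jacobiChar D N * Complex.I ^ (κ : ℂ) *
        (((N : ℝ) ^ (1 - κ / 2) : ℝ) : ℂ) *
        ∫ t in Ioi (0 : ℝ), twist (fricke κ N f) (χ⁻¹ * jacobiChar D) (imPoint t) *
          testFricke (2 - κ) N φ t := by
  have hN : (0 : ℝ) < N := by exact_mod_cast Nat.pos_of_ne_zero (NeZero.ne N)
  rw [← integral_Ioi_comp_inv_mul _ hN, ← integral_const_mul, ← integral_const_mul]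
  refine setIntegral_congr_fun measurableSet_Ioi fun x hx => ?_
  have hx' : (0 : ℝ) < x := hx
  have hNx : (0 : ℝ) < N * x := mul_pos hN hx'
  have h := twist_frickeMatrix_smul hf hND χ (imPoint x)
  rw [frickeMatrix_smul_imPoint N hx', coe_imPoint hx'] at h
  -- The principal power splits because `i` and its positive multiples have the same argument.
  have hpow : (((√(N : ℝ) : ℝ) : ℂ) * ((x : ℂ) * Complex.I)) ^ (κ : ℂ) =
      (((√(N : ℝ) * x) ^ κ : ℝ) : ℂ) * Complex.I ^ (κ : ℂ) := by
    have hs : (0 : ℝ) < √(N : ℝ) * x := mul_pos (Real.sqrt_pos.mpr hN) hx'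
    rw [← mul_assoc, ← Complex.ofReal_mul, Complex.ofReal_cpow hs.le]
    have h1 := cpow_div_mul_cpow (z := ((√(N : ℝ) * x : ℝ) : ℂ) * Complex.I) (w := Complex.I)
      (by simpa using hs) (by simp) κ
    rw [mul_div_cancel_right₀ _ Complex.I_ne_zero] at h1
    exact h1.symm
  -- The Jacobian times the weight `κ` factor is the weight `2 - κ` factor of `testFricke`, up to a
  -- power of `N`.
  have hreal : (N : ℝ) * ((N * x) ^ 2)⁻¹ * (√(N : ℝ) * x) ^ κ =
      (N : ℝ) ^ (1 - κ / 2) * (N * x) ^ (-(2 - κ)) := by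
    rw [neg_sub, Real.rpow_sub hNx, Real.mul_rpow (Real.sqrt_nonneg _) hx'.le,
      Real.mul_rpow hN.le hx'.le, Real.sqrt_eq_rpow, ← Real.rpow_mul hN.le,
      Real.rpow_sub hN, Real.rpow_one]
    have e : (N : ℝ) ^ κ = (N : ℝ) ^ (1 / 2 * κ) * (N : ℝ) ^ (κ / 2) := by
      rw [← Real.rpow_add hN]; congr 1; ring
    rw [e]
    have : (N : ℝ) ^ (κ / 2) ≠ 0 := (Real.rpow_pos_of_pos hN _).ne'
    norm_num
    field_simp
  have hrealC := congrArg (fun r : ℝ => (r : ℂ)) hreal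
  simp only [Complex.ofReal_mul] at hrealC
  rw [hpow] at h
  simp only [testFricke, Complex.ofReal_mul (N : ℝ)]
  linear_combination ((N : ℝ) : ℂ) * ((((N * x) ^ 2)⁻¹ : ℝ) : ℂ) * φ (N * x)⁻¹ * h +
    ψ (D : ZMod N) * χ (-N) * jacobiChar D N * Complex.I ^ (κ : ℂ) *
      twist (fricke κ N f) (χ⁻¹ * jacobiChar D) (imPoint x) * φ (N * x)⁻¹ * hrealC

/-! ### Test functions with compact support -/

/-- On `[α, β]` one has `exp(-st) ≤ exp(-sα) + exp(-sβ)` for either sign of `s`, so convergence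
reduces to that of the twisted expansion at `iα` and `iβ`. -/
theorem convergesAbsolutely_of_integrableOn {f : ℍ → ℂ} {a : ℤ → ℂ}
    (hf : HasFourierExpansion 1 f a) {D : ℕ} [NeZero D] (χ : DirichletCharacter ℂ D) {φ : ℝ → ℂ}
    (hφ : IntegrableOn φ (Ioi 0)) {α β : ℝ} (hα : 0 < α) (hβ : 0 < β)
    (hsupp : ∀ t, φ t ≠ 0 → α ≤ t ∧ t ≤ β) :
    ConvergesAbsolutely (twistCoeff a χ) D φ := by
  have hbound : ∀ s t : ℝ, Real.exp (-(s * t)) * ‖φ t‖ ≤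
      (Real.exp (-(s * α)) + Real.exp (-(s * β))) * ‖φ t‖ := by
    intro s t
    by_cases h0 : φ t = 0
    · simp [h0]
    obtain ⟨h1, h2⟩ := hsupp t h0
    refine mul_le_mul_of_nonneg_right ?_ (norm_nonneg _)
    rcases le_total 0 s with hs | hs
    · have : Real.exp (-(s * t)) ≤ Real.exp (-(s * α)) :=
        Real.exp_le_exp.mpr (neg_le_neg (mul_le_mul_of_nonneg_left h1 hs))
      linarith [Real.exp_pos (-(s * β))]
    · have : Real.exp (-(s * t)) ≤ Real.exp (-(s * β)) :=
        Real.exp_le_exp.mpr (neg_le_neg (mul_le_mul_of_nonpos_left h2 hs))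
      linarith [Real.exp_pos (-(s * α))]
  have hconv : ∀ s, LaplaceConverges φ s := by
    intro s
    refine (hφ.norm.const_mul (Real.exp (-(s * α)) + Real.exp (-(s * β)))).mono' ?_ ?_
    · refine AEStronglyMeasurable.mul (Continuous.aestronglyMeasurable ?_) hφ.1
      fun_prop
    · refine Filter.Eventually.of_forall fun t => ?_
      rw [norm_mul, Complex.norm_real, Real.norm_eq_abs, Real.abs_exp]
      exact hbound s t
  refine ⟨fun n _ => hconv _, ?_⟩
  have hs : ∀ {t : ℝ}, 0 < t → Summable fun n : ℤ =>
      ‖twistCoeff a χ n‖ * Real.exp (-(2 * Real.pi * n / D * t)) := by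
    intro t ht
    refine (hf.hasSum_twist_imPoint χ ht).summable.norm.congr fun n => ?_
    rw [norm_mul, Complex.norm_real, Real.norm_eq_abs, Real.abs_exp]
  refine Summable.of_nonneg_of_le (fun n => ?_) (fun n => ?_)
    (((hs hα).add (hs hβ)).mul_right (∫ t in Ioi (0 : ℝ), ‖φ t‖))
  · exact mul_nonneg (norm_nonneg _) (integral_nonneg fun t => by positivity)
  · refine le_of_le_of_eq (mul_le_mul_of_nonneg_left (b := ∫ t in Ioi (0 : ℝ),
      Real.exp (-(2 * Real.pi * n / D * t)) * ‖φ t‖) (c := (Real.exp (-(2 * Real.pi * n / D * α)) +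
      Real.exp (-(2 * Real.pi * n / D * β))) * ∫ t in Ioi (0 : ℝ), ‖φ t‖) ?_
      (norm_nonneg (twistCoeff a χ n))) (by ring)
    rw [← integral_const_mul]
    refine integral_mono ?_ (hφ.norm.const_mul _) fun t => hbound _ t
    refine (hconv (2 * Real.pi * n / D)).norm.congr (Filter.Eventually.of_forall fun t => ?_)
    simp only [norm_mul, Complex.norm_real, Real.norm_eq_abs, Real.abs_exp]

theorem PiecewiseSmooth.integrableAtFilter {φ : ℝ → ℂ} (hφ : PiecewiseSmooth φ) {x : ℝ}
    (hx : 0 < x) : IntegrableAtFilter φ (𝓝 x) := by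
  obtain ⟨g₁, g₂, hg₁, hg₂, h₁, h₂⟩ := hφ x hx
  obtain ⟨b, hb, hbx⟩ := mem_nhdsLT_iff_exists_Ioo_subset.mp h₁
  obtain ⟨c, hc, hcx⟩ := mem_nhdsGT_iff_exists_Ioo_subset.mp h₂
  refine ⟨Ioo b c, Ioo_mem_nhds hb hc, ?_⟩
  have hb' : IntegrableOn φ (Ioo b x) :=
    ((hg₁.continuous.integrableOn_Icc (a := b) (b := x)).mono_set Ioo_subset_Icc_self).congr_fun
      (fun y hy => (hbx hy).symm) measurableSet_Ioo
  have hc' : IntegrableOn φ (Ioo x c) :=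
    ((hg₂.continuous.integrableOn_Icc (a := x) (b := c)).mono_set Ioo_subset_Icc_self).congr_fun
      (fun y hy => (hcx hy).symm) measurableSet_Ioo
  have hx' : IntegrableOn φ {x} := integrableOn_singleton (hx := by simp)
  refine ((hb'.union hx').union hc').mono_set fun y hy => ?_
  rcases lt_trichotomy y x with h | h | h
  · exact Or.inl (Or.inl ⟨hy.1, h⟩)
  · exact Or.inl (Or.inr h)
  · exact Or.inr ⟨h, hy.2⟩

theorem PiecewiseSmooth.integrableOn {φ : ℝ → ℂ} (hφ : PiecewiseSmooth φ)
    (hφc : HasCompactSupport φ) (hφ0 : tsupport φ ⊆ Ioi 0) : IntegrableOn φ (Ioi 0) := by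
  have h : LocallyIntegrableOn φ (tsupport φ) := fun x hx =>
    (hφ.integrableAtFilter (hφ0 hx)).filter_mono nhdsWithin_le_nhds
  have h2 := h.integrableOn_isCompact hφc
  exact ((integrableOn_iff_integrable_of_support_subset (subset_tsupport φ)).mp h2).integrableOn

theorem exists_bounds_of_tsupport_subset {φ : ℝ → ℂ} (hφc : HasCompactSupport φ)
    (hφ0 : tsupport φ ⊆ Ioi 0) :
    ∃ α β : ℝ, 0 < α ∧ 0 < β ∧ ∀ t, φ t ≠ 0 → α ≤ t ∧ t ≤ β := by
  rcases (tsupport φ).eq_empty_or_nonempty with he | hne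
  -- Here `φ = 0`, and any positive bounds serve.
  · refine ⟨1, 1, one_pos, one_pos, fun t ht => ?_⟩
    have := subset_tsupport φ ht
    simp [he] at this
  · have h1 := hφc.isCompact.sInf_mem hne
    have h2 := hφc.isCompact.sSup_mem hne
    refine ⟨_, _, hφ0 h1, hφ0 h2, fun t ht => ?_⟩
    have := subset_tsupport φ ht
    exact ⟨csInf_le hφc.isCompact.bddBelow this, le_csSup hφc.isCompact.bddAbove this⟩

/-- Up to the Jacobian, this is the inversion of `φ(s) s^(k-2)`, whose power factor is continuous on
`[α, β]`. -/
theorem integrableOn_testFricke {k : ℝ} {M : ℕ} [NeZero M] {φ : ℝ → ℂ}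
    (hφ : IntegrableOn φ (Ioi 0)) {α β : ℝ} (hα : 0 < α)
    (hsupp : ∀ t, φ t ≠ 0 → α ≤ t ∧ t ≤ β) : IntegrableOn (testFricke k M φ) (Ioi 0) := by
  have hM : (0 : ℝ) < M := by exact_mod_cast Nat.pos_of_ne_zero (NeZero.ne M)
  have hcont : ContinuousOn (fun s : ℝ => ((s ^ (k - 2) : ℝ) : ℂ)) (Icc α β) :=
    Complex.continuous_ofReal.comp_continuousOn
      (continuousOn_id.rpow_const fun s hs => Or.inl (hα.trans_le hs.1).ne')
  have hG : IntegrableOn (fun s : ℝ => φ s * ((s ^ (k - 2) : ℝ) : ℂ)) (Ioi 0) :=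
    ((integrableOn_iff_integrable_of_support_subset
      (fun s hs => hsupp s (left_ne_zero_of_mul hs))).mp
      ((hφ.mono_set fun s hs => hα.trans_le hs.1).mul_continuousOn hcont
        isCompact_Icc)).integrableOn
  refine (integrableOn_Ioi_comp_inv_mul hG hM).congr_fun (fun x hx => ?_) measurableSet_Ioi
  have hx' : (0 : ℝ) < M * x := mul_pos hM hx
  have e : ((M * x) ^ 2)⁻¹ * ((M * x)⁻¹) ^ (k - 2) = (M * x) ^ (-k) := by
    rw [← Real.rpow_natCast, ← Real.rpow_neg hx'.le, Real.inv_rpow hx'.le,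
      ← Real.rpow_neg hx'.le, ← Real.rpow_add hx']
    congr 1
    push_cast
    ring
  simp only [testFricke, ← e]
  push_cast
  ring

theorem testFricke_support {k : ℝ} {M : ℕ} [NeZero M] {φ : ℝ → ℂ} {α β : ℝ} (hα : 0 < α)
    (hβ : 0 < β) (hsupp : ∀ t, φ t ≠ 0 → α ≤ t ∧ t ≤ β) (t : ℝ) (ht : testFricke k M φ t ≠ 0) :
    (M * β)⁻¹ ≤ t ∧ t ≤ (M * α)⁻¹ := by
  have hM : (0 : ℝ) < M := by exact_mod_cast Nat.pos_of_ne_zero (NeZero.ne M)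
  obtain ⟨h1, h2⟩ := hsupp _ (left_ne_zero_of_mul ht)
  have h3 : 0 < (M * t)⁻¹ := hα.trans_le h1
  have h4 : 0 < t := pos_of_mul_pos_right (inv_pos.mp h3) hM.le
  constructor
  · rw [inv_le_iff_one_le_mul₀ (by positivity)]
    rw [inv_le_iff_one_le_mul₀ (by positivity)] at h2
    linarith
  · rw [le_inv_comm₀ h4 (by positivity)]
    rw [le_inv_comm₀ hα (by positivity)] at h1
    rw [le_inv_comm₀ (by positivity) h4]
    rwa [mul_inv, ← div_eq_inv_mul, le_div_iff₀ hM, mul_comm]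

/-! ### The summation formula -/

theorem laplace_smul (c : ℂ) (φ : ℝ → ℂ) (s : ℝ) : laplace (c • φ) s = c * laplace φ s := by
  rw [laplace, laplace, ← integral_const_mul]
  congr 1
  ext t
  simp only [Pi.smul_apply, smul_eq_mul]
  ring

theorem LValue_smul (a : ℤ → ℂ) {D : ℕ} [NeZero D] (χ : DirichletCharacter ℂ D) (c : ℂ)
    (φ : ℝ → ℂ) : LValue a χ (c • φ) = c * LValue a χ φ := by
  simp only [LValue, laplace_smul, ← tsum_mul_left]
  exact tsum_congr fun n => by ring

/-- The defining property of `α_D(φ)`, in terms of `L`-values. -/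
theorem LValue_eq_of_isAlpha {k : ℝ} {h : ℝ → ℂ} {ℓ a : ℤ → ℂ} (hhℓ : ∀ n : ℤ, h n = ℓ n)
    (ha0 : a 0 = 0) {D : ℕ} [NeZero D] {χ : DirichletCharacter ℂ D} {φ A : ℝ → ℂ}
    (hA : IsAlpha k h D φ A)
    (hconv : ∀ n : ℤ, twistCoeff a χ n ≠ 0 → LaplaceConverges A (2 * Real.pi * n / D)) :
    LValue (fun n => a n * ℓ n * (n : ℂ) ^ ((k - 1 : ℝ) : ℂ)) χ φ = LValue a χ A := by
  refine tsum_congr fun n => ?_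
  by_cases h0 : twistCoeff a χ n = 0
  · have : twistCoeff (fun n => a n * ℓ n * (n : ℂ) ^ ((k - 1 : ℝ) : ℂ)) χ n = 0 := by
      simp only [twistCoeff] at h0 ⊢
      linear_combination (ℓ n * (n : ℂ) ^ ((k - 1 : ℝ) : ℂ)) * h0
    rw [h0, this, zero_mul, zero_mul]
  -- The inverse Laplace identity is only available at `p ≠ 0`.
  · have hn : n ≠ 0 := by
      rintro rfl
      exact h0 (by rw [twistCoeff, ha0, zero_mul])
    have hnR : (n : ℝ) ≠ 0 := by exact_mod_cast hn
    have hD : (D : ℝ) ≠ 0 := by exact_mod_cast NeZero.ne D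
    have hp : (2 * Real.pi * n / D : ℝ) ≠ 0 := by
      have := Real.pi_pos
      positivity
    have e : D * (2 * Real.pi * n / D) / (2 * Real.pi) = (n : ℝ) := by
      have := Real.pi_ne_zero
      field_simp
    rw [hA.2 _ hp (hconv n h0)]
    dsimp only
    rw [e, hhℓ]
    simp only [twistCoeff]
    push_cast
    ring

/-! ### Comparison of the constants -/

theorem eps_sq {D : ℕ} [NeZero D] (hD : Odd D) : eps D ^ 2 = jacobiChar D (-1) := by
  have h : jacobiChar D (-1) = ((jacobiSym (-1) D : ℤ) : ℂ) := by
    rw [← jacobiChar_intCast]; simp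
  rw [h, jacobiSym.at_neg_one hD, eps]
  have h4 : D % 4 = 1 ∨ D % 4 = 3 := by
    obtain ⟨r, rfl⟩ := hD; omega
  rcases h4 with h4 | h4
  · rw [ZMod.χ₄_nat_one_mod_four h4, if_pos (by omega)]; simp
  · rw [ZMod.χ₄_nat_three_mod_four h4, if_neg (by omega)]; simp

theorem eps_pow_four (d : ℤ) : eps d ^ 4 = 1 := by
  unfold eps; split_ifs <;> simp

/-- The comparison of the constants in the functional equations of weights `2 - k` and `k`. -/
theorem constants_eq (m : ℕ) (k : ℝ) (hk : k = m + 1 / 2) {N N' : ℕ} [NeZero N] [NeZero N']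
    (hN : 4 ∣ N) (ψ : DirichletCharacter ℂ N) (ψ' : DirichletCharacter ℂ N') {D : ℕ} [NeZero D]
    (hD : D.Coprime (N * N')) (χ : DirichletCharacter ℂ D) (lam : ℂ) :
    eps D ^ ((2 * k : ℝ) : ℂ) *
      (ψ (D : ZMod N) * χ (-N) * jacobiChar D N * Complex.I ^ ((2 - k : ℝ) : ℂ) *
        (((N : ℝ) ^ (1 - (2 - k) / 2) : ℝ) : ℂ)) * bConst m k ψ ψ' χ lam =
    eps D ^ ((2 * (2 - k) : ℝ) : ℂ) *
      (ψ' (D : ZMod N') * χ (-N') * jacobiChar D N' * Complex.I ^ (k : ℂ) *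
        (((N' : ℝ) ^ (1 - k / 2) : ℝ) : ℂ)) * lam := by
  have hNp : (0 : ℝ) < N := by exact_mod_cast Nat.pos_of_ne_zero (NeZero.ne N)
  have hNp' : (0 : ℝ) < N' := by exact_mod_cast Nat.pos_of_ne_zero (NeZero.ne N')
  have hDN : D.Coprime N := hD.coprime_mul_right_right
  have hDN' : D.Coprime N' := hD.coprime_mul_left_right
  have hU : IsUnit (N : ZMod D) := (ZMod.isUnit_iff_coprime N D).mpr hDN.symm
  have hψ : ψ (D : ZMod N) ≠ 0 :=
    (((ZMod.isUnit_iff_coprime D N).mpr hDN).map ψ).ne_zero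
  have hodd : Odd D := by
    rw [← Nat.not_even_iff_odd, even_iff_two_dvd]
    intro h2
    have := Nat.dvd_gcd h2 ((by norm_num : 2 ∣ 4).trans hN)
    rw [hDN] at this
    omega
  have hinv : (N : ZMod D) * (N : ZMod D)⁻¹ = 1 := ZMod.mul_inv_of_unit _ hU
  set q : ZMod D := (N' : ZMod D) * (N : ZMod D)⁻¹ with hq
  have hNq : (N : ZMod D) * q = N' := by
    rw [hq, mul_left_comm, hinv, mul_one]
  have hχ : χ (-N') = χ (-N) * χ q := by
    rw [← map_mul, neg_mul, hNq]
  have hJ : jacobiChar D N' = jacobiChar D N * jacobiChar D q := by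
    rw [← map_mul, hNq]
  have hJ1 : jacobiChar D ((-1) ^ (2 * m + 1) * q) = jacobiChar D (-1) * jacobiChar D q := by
    rw [map_mul, Odd.neg_one_pow ⟨m, rfl⟩]
  -- `k - (2 - k) = 2k - 2 = 2m - 1`.
  have hI : Complex.I ^ (k : ℂ) =
      Complex.I ^ ((2 - k : ℝ) : ℂ) * Complex.I ^ (2 * (m : ℤ) - 1) := by
    rw [← Complex.cpow_intCast, ← Complex.cpow_add _ _ Complex.I_ne_zero]
    congr 1
    rw [hk]; push_cast; ring
  -- The exponents differ by `4m - 2`; since `ε_D^4 = 1`, the discrepancy is `ε_D^2 = ψ_D(-1)`,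
  -- which is the sign inside `b`.
  have he : eps D ^ ((2 * k : ℝ) : ℂ) * jacobiChar D (-1) =
      eps D ^ ((2 * (2 - k) : ℝ) : ℂ) := by
    have h1 : ((2 * k : ℝ) : ℂ) = ((2 * (2 - k) : ℝ) : ℂ) + ((4 * m - 2 : ℤ) : ℂ) := by
      rw [hk]; push_cast; ring
    have h2 : eps D ^ (4 * (m : ℤ) - 2) * eps D ^ 2 = 1 := by
      rw [← zpow_natCast (eps D) 2, ← zpow_add₀ (eps_ne_zero _)]
      have : 4 * (m : ℤ) - 2 + ((2 : ℕ) : ℤ) = ((4 : ℕ) : ℤ) * m := by push_cast; ring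
      rw [this, zpow_mul, zpow_natCast (eps D) 4, eps_pow_four, one_zpow]
    rw [h1, Complex.cpow_add _ _ (eps_ne_zero _), Complex.cpow_intCast, ← eps_sq hodd, mul_assoc,
      h2, mul_one]
  -- The powers of `N` cancel, as `1 - (2 - k)/2 = k/2`.
  have hR : (N : ℝ) ^ (1 - (2 - k) / 2) * ((N : ℝ) * N') ^ (-(k / 2)) * N' =
      (N' : ℝ) ^ (1 - k / 2) := by
    rw [Real.mul_rpow hNp.le hNp'.le, ← mul_assoc, ← Real.rpow_add hNp, sub_eq_add_neg 1 (k / 2),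
      Real.rpow_add hNp', Real.rpow_one]
    rw [show 1 - (2 - k) / 2 + -(k / 2) = 0 by ring, Real.rpow_zero]
    ring
  have hRC := congrArg (fun r : ℝ => (r : ℂ)) hR
  simp only [Complex.ofReal_mul, Complex.ofReal_natCast] at hRC
  have hd : ψ (D : ZMod N) * (ψ' (D : ZMod N') / ψ (D : ZMod N)) = ψ' (D : ZMod N') :=
    mul_div_cancel₀ _ hψ
  rw [bConst, ← hq, hJ1, hχ, hJ, hI, ← hRC, ← he]
  linear_combination (eps D ^ ((2 * k : ℝ) : ℂ) * χ (-N) * jacobiChar D N *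
    Complex.I ^ ((2 - k : ℝ) : ℂ) * (((N : ℝ) ^ (1 - (2 - k) / 2) : ℝ) : ℂ) *
    Complex.I ^ (2 * (m : ℤ) - 1) * lam * jacobiChar D (-1) * jacobiChar D q * χ q *
    ((((N : ℝ) * N') ^ (-(k / 2)) : ℝ) : ℂ) * N') * hd

end HalfIntegralBol

end

/-! ### Proof of the summation formula -/

theorem mainTheorem7
    (m : ℕ) (hm : 1 ≤ m) (k : ℝ) (hk : k = m + 1 / 2)
    (N N' : ℕ) [NeZero N] [NeZero N'] (hN : 4 ∣ N) (hN' : 4 ∣ N')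
    (ψ : DirichletCharacter ℂ N) (ψ' : DirichletCharacter ℂ N')
    (ℓ : ℤ → ℂ) (hℓ : ∃ C : ℝ, ∀ n : ℤ, ‖ℓ n‖ ≤ C)
    (T : HalfIntegralBol.WeaklyHolomorphic (2 - k) N ψ →ₗ[ℂ]
      HalfIntegralBol.WeaklyHolomorphic k N' ψ')
    (hT : ∀ (f : HalfIntegralBol.WeaklyHolomorphic (2 - k) N ψ) (a : ℤ → ℂ),
      HalfIntegralBol.HasFourierExpansion 1 (f : ℍ → ℂ) a →
      HalfIntegralBol.HasFourierExpansion 1 (T f : ℍ → ℂ)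
        (fun n => a n * ℓ n * (n : ℂ) ^ ((k - 1 : ℝ) : ℂ)))
    (lam : HalfIntegralBol.WeaklyHolomorphic (2 - k) N ψ → ℂ)
    (hlam : ∀ (f : HalfIntegralBol.WeaklyHolomorphic (2 - k) N ψ) (c : ℂ),
      HalfIntegralBol.fricke (2 - k) N (f : ℍ → ℂ) = c • (f : ℍ → ℂ) →
      HalfIntegralBol.fricke k N' (T f : ℍ → ℂ) = (c * lam f) • (T f : ℍ → ℂ))
    (h : ℝ → ℂ) (hh : ContDiffOn ℝ ∞ h (Set.Ioi 0)) (hhℓ : ∀ n : ℤ, h n = ℓ n)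
    (f : HalfIntegralBol.WeaklyHolomorphic (2 - k) N ψ)
    (hf : HalfIntegralBol.IsCuspidal (2 - k) (f : ℍ → ℂ))
    (c : ℂ) (hc : HalfIntegralBol.fricke (2 - k) N (f : ℍ → ℂ) = c • (f : ℍ → ℂ))
    (a : ℤ → ℂ) (ha : HalfIntegralBol.HasFourierExpansion 1 (f : ℍ → ℂ) a)
    (D : ℕ) [NeZero D] (hD : D.Coprime (N * N')) (χ : DirichletCharacter ℂ D)
    (φ : ℝ → ℂ) (hφ : HalfIntegralBol.PiecewiseSmooth φ)
    (hφc : HasCompactSupport φ) (hφ0 : tsupport φ ⊆ Set.Ioi 0)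
    (A B : ℝ → ℂ)
    (hA : HalfIntegralBol.IsAlpha k h D φ A)
    (hB : HalfIntegralBol.IsAlpha k h D (HalfIntegralBol.testFricke (2 - k) N' φ) B)
    (hA₁ : A ∈ HalfIntegralBol.testClass (HalfIntegralBol.twistCoeff a χ) D)
    (hA₂ : HalfIntegralBol.testFricke k N A ∈ HalfIntegralBol.testClass
      (HalfIntegralBol.twistCoeff a (χ⁻¹ * HalfIntegralBol.jacobiChar D)) D)
    (hB₁ : B ∈ HalfIntegralBol.testClass
      (HalfIntegralBol.twistCoeff a (χ⁻¹ * HalfIntegralBol.jacobiChar D)) D) :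
    HalfIntegralBol.LValue a (χ⁻¹ * HalfIntegralBol.jacobiChar D)
        (HalfIntegralBol.testFricke k N A) =
      HalfIntegralBol.LValue a (χ⁻¹ * HalfIntegralBol.jacobiChar D)
        (HalfIntegralBol.bConst m k ψ ψ' χ (lam f) • B) := by
  have hNp : (0 : ℝ) < N := by exact_mod_cast Nat.pos_of_ne_zero (NeZero.ne N)
  have hDN : D.Coprime N := hD.coprime_mul_right_right
  have hU : IsUnit (N : ZMod D) := (ZMod.isUnit_iff_coprime N D).mpr hDN.symm
  have hU' : IsUnit (N' : ZMod D) :=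
    (ZMod.isUnit_iff_coprime N' D).mpr hD.coprime_mul_left_right.symm
  have ha0 := hf.apply_zero ha
  set χ' := χ⁻¹ * HalfIntegralBol.jacobiChar D with hχ'
  set g : ℍ → ℂ := (T f : ℍ → ℂ) with hg
  have hga : HalfIntegralBol.HasFourierExpansion 1 g _ := hT f a ha
  obtain ⟨α, β, hα, hβ, hsupp⟩ := HalfIntegralBol.exists_bounds_of_tsupport_subset hφc hφ0
  have hφi := hφ.integrableOn hφc hφ0
  have hNp' : (0 : ℝ) < N' := by exact_mod_cast Nat.pos_of_ne_zero (NeZero.ne N')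
  -- Convergence against the coefficients of `g` is not a hypothesis; it comes from the compact
  -- support of `φ`.
  have hφW := HalfIntegralBol.convergesAbsolutely_of_integrableOn hga χ'
    (HalfIntegralBol.integrableOn_testFricke (k := 2 - k) (M := N') hφi hα hsupp)
    (by positivity : 0 < (N' * β)⁻¹) (by positivity : 0 < (N' * α)⁻¹)
    (HalfIntegralBol.testFricke_support hα hβ hsupp)
  have hX : HalfIntegralBol.LValue a χ A = ∫ t in Set.Ioi (0 : ℝ), HalfIntegralBol.twist f χ (HalfIntegralBol.imPoint t) * A t :=
    HalfIntegralBol.LValue_eq_integral ha hA₁.2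
  have hX' : HalfIntegralBol.LValue a χ A = ∫ t in Set.Ioi (0 : ℝ), HalfIntegralBol.twist g χ (HalfIntegralBol.imPoint t) * φ t := by
    rw [← HalfIntegralBol.LValue_eq_of_isAlpha hhℓ ha0 hA hA₁.2.1]
    exact HalfIntegralBol.LValue_eq_integral hga (HalfIntegralBol.convergesAbsolutely_of_integrableOn hga χ hφi hα hβ hsupp)
  have hY := HalfIntegralBol.LValue_eq_integral ha hA₂.2
  have hB' := HalfIntegralBol.LValue_eq_integral ha hB₁.2
  have hZ := (HalfIntegralBol.LValue_eq_of_isAlpha hhℓ ha0 hB hB₁.2.1).symm.trans (HalfIntegralBol.LValue_eq_integral hga hφW)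
  rw [HalfIntegralBol.LValue_smul]
  -- If `c = 0`, then `f = 0` because `W_N` acts as an involution on points, and both sides vanish.
  rcases eq_or_ne c 0 with rfl | hc0
  · have hf0 : ∀ z, (f : ℍ → ℂ) z = 0 := by
      intro z
      rw [← HalfIntegralBol.frickeMatrix_smul_frickeMatrix_smul N z, HalfIntegralBol.apply_frickeMatrix_smul (2 - k) N f, hc]
      simp
    rw [hY, hB']
    simp [HalfIntegralBol.twist, hf0]
  have E₁ := HalfIntegralBol.integral_twist_functional_equation f.2.2.1 hU χ A
  have E₂ := HalfIntegralBol.integral_twist_functional_equation (T f).2.2.1 hU' χ φ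
  rw [hlam f c hc] at E₂
  rw [hc, sub_sub_cancel] at E₁
  have hsmul : ∀ (c : ℂ) (F : ℍ → ℂ) (η : ℝ → ℂ),
      ∫ t in Set.Ioi (0 : ℝ), HalfIntegralBol.twist (c • F) χ' (HalfIntegralBol.imPoint t) * η t =
        c * ∫ t in Set.Ioi (0 : ℝ), HalfIntegralBol.twist F χ' (HalfIntegralBol.imPoint t) * η t :=
    fun c F η => by
      simp only [HalfIntegralBol.twist_smul, mul_assoc, MeasureTheory.integral_const_mul]
  rw [hsmul] at E₁ E₂
  rw [← hX, ← hY] at E₁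
  rw [← hX', ← hZ] at E₂
  have hconst := HalfIntegralBol.constants_eq m k hk hN ψ ψ' hD χ (lam f)
  set C₁ := ψ (D : ZMod N) * χ (-N) * HalfIntegralBol.jacobiChar D N * Complex.I ^ ((2 - k : ℝ) : ℂ) *
    (((N : ℝ) ^ (1 - (2 - k) / 2) : ℝ) : ℂ) with hC₁
  have hC₁0 : C₁ ≠ 0 := by
    have h1 : ψ (D : ZMod N) ≠ 0 := (((ZMod.isUnit_iff_coprime D N).mpr hDN).map ψ).ne_zero
    have h2 : χ (-N) ≠ 0 := (hU.neg.map χ).ne_zero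
    have h3 : HalfIntegralBol.jacobiChar D N ≠ 0 := (hU.map (HalfIntegralBol.jacobiChar D)).ne_zero
    have h4 : Complex.I ^ ((2 - k : ℝ) : ℂ) ≠ 0 := by
      rw [Complex.cpow_def_of_ne_zero Complex.I_ne_zero]
      exact Complex.exp_ne_zero _
    have h5 : (((N : ℝ) ^ (1 - (2 - k) / 2) : ℝ) : ℂ) ≠ 0 := by
      exact_mod_cast (Real.rpow_pos_of_pos hNp _).ne'
    exact mul_ne_zero (mul_ne_zero (mul_ne_zero (mul_ne_zero h1 h2) h3) h4) h5
  have he : HalfIntegralBol.eps D ^ ((2 * k : ℝ) : ℂ) ≠ 0 := by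
    rw [Complex.cpow_def_of_ne_zero (HalfIntegralBol.eps_ne_zero _)]
    exact Complex.exp_ne_zero _
  -- `E₁` and `E₂` express the same number `L_f(χ, A)`; eliminating it leaves the claim times this
  -- nonzero factor.
  refine mul_left_cancel₀ (mul_ne_zero (mul_ne_zero he hC₁0) hc0) ?_
  linear_combination (-HalfIntegralBol.eps D ^ ((2 * k : ℝ) : ℂ)) * E₁ +
    HalfIntegralBol.eps D ^ ((2 * (2 - k) : ℝ) : ℂ) * E₂ - c * HalfIntegralBol.LValue a χ' B * hconst
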